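/- Let $n\ge 1$ and let $x^\star\in\mathbb R^n$ have non-negative entries, exactly $s$ of which are non-zero. Consider the program $$\min \|x\|_1\quad\text{subject to}\quad Ax=Ax^\star,\ x\ge 0,$$ and its prior restricted cone $$C_3=\{u\in\mathbb R^n:\ \exists\, t>0,\ \|x^\star+tu\|_1\le\|x^\star\|_1\ \text{and}\ I_{\mathbb R^n_+}(x^\star+tu)\le I_{\mathbb R^n_+}(x^\star)\},$$ where $I_{\mathbb R^n_+}$ is $0$ on the non-negative orthant $\mathbb R^n_+$ and $+\infty$ elsewhere (so the second condition says $x^\star+tu\ge 0$). For a convex cone $K\subseteq\mathbb R^n$ let $$\delta(K)=\mathbb E\Big(\sup_{t\in K,\ \|t\|_2\le 1}\langle g,t\rangle\Big)^2,\qquad g\sim N(0,I_n),$$ be its statistical dimension. Let $\varphi(u)=\sqrt{2/\pi}\,e^{-u^2/2}$ and, for $\rho\in[0,1]$, $$\psi_2(\rho)=\inf_{\tau\ge 0}\Big\{\rho(1+\tau^2)+\tfrac12(1-\rho)\int_\tau^\infty (u-\tau)^2\varphi(u)\,du\Big\}.$$ Then $\psi_2$ maps $[0,1]$ into $[0,1]$,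 and $$\psi_2(s/n)-\frac{2}{\sqrt{sn}}\ \le\ \frac{\delta(C_3)}{n}\ \le\ \psi_2(s/n),$$ where the lower bound is claimed for $s\ge 1$ and the upper bound for every $s\ge0$. Moreover, for $0<\rho<1$ the stationary equation $$\frac{2\rho}{1-\rho}=\int_\tau^\infty\Big(\frac u\tau-1\Big)\varphi(u)\,du$$ has exactly one solution $\tau>0$, and the infimum defining $\psi_2(\rho)$ is attained at this $\tau$ and at no other point of $[0,\infty)$. For $\rho=1$ (where the left side of the equation is $+\infty$) the infimum is attained exactly at $\tau=0$. -/

import Mathlib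

open MeasureTheory ProbabilityTheory

namespace PriorCone

noncomputable section

/-- The indicator function of a set `C` in the sense of convex analysis: `0` on `C` and `∞` off `C`. -/
def convexIndicator {E : Type*} (C : Set E) (x : E) : EReal :=
  open Classical in if x ∈ C then 0 else ⊤

/-- The prior restricted cone at the true signal `x` of the program that minimizes `f 0` subject to
`A z = A x` and `f i z ≤ f i x` for `1 ≤ i ≤ k`. It does not depend on `A`. -/
def priorRestrictedCone {E : Type*} [AddCommGroup E] [Module ℝ E] {k : ℕ}
    (f : Fin (k + 1) → E → EReal) (x : E) : Set E :=
  {u | ∃ t : ℝ, 0 < t ∧ ∀ i, f i (x + t • u) ≤ f i x}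

/-- `sup_{t ∈ K ∩ B} ⟨g, t⟩`, with `B` the closed Euclidean unit ball. -/
def coneSupport {n : ℕ} (K : Set (EuclideanSpace ℝ (Fin n))) (g : EuclideanSpace ℝ (Fin n)) : ℝ :=
  sSup ((fun t => inner ℝ g t) '' (K ∩ Metric.closedBall 0 1))

/-- The statistical dimension `δ(K) = E (sup_{t ∈ K ∩ B} ⟨g, t⟩)²`, where `g ~ N(0, I_n)`. -/
def statDim {n : ℕ} (K : Set (EuclideanSpace ℝ (Fin n))) : ℝ :=
  ∫ g, coneSupport K g ^ 2 ∂(stdGaussian (EuclideanSpace ℝ (Fin n)))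

/-- The non-negative orthant. -/
def nonnegOrthant (n : ℕ) : Set (EuclideanSpace ℝ (Fin n)) := {x | ∀ i, 0 ≤ x i}

/-- The functions of the program `min ‖x‖₁` subject to `y = A x`, `x ≥ 0`: the objective
`f 0 = ‖·‖₁`, and the prior constraint function `f 1`, the indicator of the orthant. -/
def l1NonnegFunctions (n : ℕ) : Fin 2 → EuclideanSpace ℝ (Fin n) → EReal :=
  ![fun x => ((∑ i, |x i| : ℝ) : EReal), convexIndicator (nonnegOrthant n)]

/-- `φ(u) = √(2/π) e^{-u²/2}`. -/
def phi (u : ℝ) : ℝ := √(2 / Real.pi) * Real.exp (-u ^ 2 / 2)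

/-- The function of `τ` whose infimum over `τ ≥ 0` is `ψ₂(ρ)`. -/
def psi2Objective (ρ τ : ℝ) : ℝ :=
  ρ * (1 + τ ^ 2) + (1 / 2) * (1 - ρ) * ∫ u in Set.Ioi τ, (u - τ) ^ 2 * phi u

/-- `ψ₂(ρ) = inf_{τ ≥ 0} (ρ (1 + τ²) + ½ (1 - ρ) ∫_τ^∞ (u - τ)² φ(u) du)`. -/
def psi2 (ρ : ℝ) : ℝ := sInf (psi2Objective ρ '' Set.Ici 0)

/-- The stationary equation `2ρ / (1 - ρ) = ∫_τ^∞ (u / τ - 1) φ(u) du`. -/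
def IsStationary (ρ τ : ℝ) : Prop :=
  2 * ρ / (1 - ρ) = ∫ u in Set.Ioi τ, (u / τ - 1) * phi u

theorem zero_mem_priorRestrictedCone {E : Type*} [AddCommGroup E] [Module ℝ E] {k : ℕ}
    (f : Fin (k + 1) → E → EReal) (x : E) : (0 : E) ∈ priorRestrictedCone f x :=
  ⟨1, one_pos, fun i => by simp⟩

theorem coneSupport_bddAbove {n : ℕ} (K : Set (EuclideanSpace ℝ (Fin n)))
    (g : EuclideanSpace ℝ (Fin n)) :
    BddAbove ((fun t => inner ℝ g t) '' (K ∩ Metric.closedBall 0 1)) := by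
  refine ⟨‖g‖, ?_⟩
  rintro _ ⟨t, ⟨-, ht⟩, rfl⟩
  rw [mem_closedBall_zero_iff] at ht
  exact (real_inner_le_norm g t).trans (mul_le_of_le_one_right (norm_nonneg g) ht)

theorem coneSupport_lipschitz {n : ℕ} {K : Set (EuclideanSpace ℝ (Fin n))} (h0 : 0 ∈ K) :
    LipschitzWith 1 (coneSupport K) := by
  refine LipschitzWith.of_le_add_mul 1 fun g g' => ?_
  refine csSup_le ⟨_, 0, ⟨h0, by simp⟩, rfl⟩ ?_
  rintro _ ⟨t, ht, rfl⟩
  have h1 : inner ℝ g' t ≤ coneSupport K g' := le_csSup (coneSupport_bddAbove K g') ⟨t, ht, rfl⟩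
  have h2 : inner ℝ (g - g') t ≤ ‖g - g'‖ :=
    (real_inner_le_norm _ t).trans
      (mul_le_of_le_one_right (norm_nonneg _) (mem_closedBall_zero_iff.1 ht.2))
  rw [inner_sub_left] at h2
  simp only [NNReal.coe_one, one_mul, dist_eq_norm]
  linarith

/-- The expectation in the definition of the statistical dimension is that of an integrable
function. -/
theorem integrable_coneSupport_sq {n : ℕ} {K : Set (EuclideanSpace ℝ (Fin n))} (h0 : 0 ∈ K) :
    Integrable (fun g => coneSupport K g ^ 2) (stdGaussian (EuclideanSpace ℝ (Fin n))) := by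
  have hL := coneSupport_lipschitz h0
  have hz : coneSupport K 0 = 0 := by
    have : (fun t => inner ℝ (0 : EuclideanSpace ℝ (Fin n)) t) '' (K ∩ Metric.closedBall 0 1)
        = {0} := by
      ext y
      constructor
      · rintro ⟨t, -, rfl⟩
        simp
      · rintro rfl
        exact ⟨0, ⟨h0, by simp⟩, by simp⟩
    rw [coneSupport, this, csSup_singleton]
  have hm : MemLp (coneSupport K) 2 (stdGaussian (EuclideanSpace ℝ (Fin n))) := by
    refine MemLp.of_le (IsGaussian.memLp_two_id (μ := stdGaussian (EuclideanSpace ℝ (Fin n))))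
      hL.continuous.aestronglyMeasurable (Filter.Eventually.of_forall fun g => ?_)
    have h := hL.dist_le_mul g 0
    simpa [hz, dist_eq_norm] using h
  exact hm.integrable_sq

end

end PriorCone

/-! Since `‖·‖₁` is linear on the orthant, the cone is cut out by `u i ≥ 0` off the support and `∑ u
i ≤ 0`. Lagrangian duality with multiplier `τ ≥ 0` for the last constraint makes the squared support
function at `g` the minimum over `τ` of `F g τ = ∑ residual²`, and `E (F g τ) = n * psi2Objective
(s/n) τ`. The upper bound is `E min ≤ min E` (`coneSupport_sq_le`).

For the lower bound, `F g` has curvature at least that of `s τ²`, so `min F g ≥ F g τ - Y²/s` with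
`Y = ∑ residual` (`coneSupport_sq_ge`). At the stationary `τ`, `E Y = 0`, so `E Y²` is a variance,
at most `V = (n - s) * sqExcess τ + s`. Integration by parts (`mul_sqExcess_le`) gives `V ≤ 3s`;
also `V ≤ n`, hence `V ≤ 2√(sn)`.

The claims on minimizers follow from strong convexity of the objective (`psi2Objective_ge`). -/

namespace PriorCone

open Set Filter Topology

/-! ### Gaussian excess moments -/

/-- `E (g - τ)₊` for a standard Gaussian `g`. -/
noncomputable def meanExcess (τ : ℝ) : ℝ := ∫ u, max (u - τ) 0 ∂(gaussianReal 0 1)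

/-- `E (g - τ)₊²` for a standard Gaussian `g`. -/
noncomputable def sqExcess (τ : ℝ) : ℝ := ∫ u, max (u - τ) 0 ^ 2 ∂(gaussianReal 0 1)

theorem phi_eq_two_mul_gaussianPDFReal (u : ℝ) : phi u = 2 * gaussianPDFReal 0 1 u := by
  have h : √(2 / Real.pi) = 2 * (√(2 * Real.pi))⁻¹ := by
    rw [Real.sqrt_div (by norm_num), Real.sqrt_mul (by norm_num), mul_inv]
    have h2 : √(2 : ℝ) ≠ 0 := by positivity
    have h3 : √(2 : ℝ) * √2 = 2 := Real.mul_self_sqrt (by norm_num)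
    field_simp
    linarith
  rw [phi, h, gaussianPDFReal]
  simp
  ring

theorem setIntegral_mul_phi (f : ℝ → ℝ) (τ : ℝ) :
    ∫ u in Ioi τ, f u * phi u = 2 * ∫ u, (Ioi τ).indicator f u ∂(gaussianReal 0 1) := by
  rw [integral_gaussianReal_eq_integral_smul one_ne_zero, ← integral_indicator measurableSet_Ioi,
    ← integral_const_mul]
  refine integral_congr_ae (Eventually.of_forall fun u => ?_)
  by_cases h : u ∈ Ioi τ
  · simp [indicator_of_mem h, phi_eq_two_mul_gaussianPDFReal]
    ring
  · simp [indicator_of_notMem h]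

theorem psi2Objective_eq (ρ τ : ℝ) :
    psi2Objective ρ τ = ρ * (1 + τ ^ 2) + (1 - ρ) * sqExcess τ := by
  have h : (Ioi τ).indicator (fun u : ℝ => (u - τ) ^ 2) = fun u => max (u - τ) 0 ^ 2 := by
    ext u
    by_cases h : u ∈ Ioi τ
    · rw [indicator_of_mem h, max_eq_left (by simpa using (mem_Ioi.1 h).le)]
    · rw [indicator_of_notMem h, max_eq_right (by simpa using h)]
      simp
  rw [psi2Objective, setIntegral_mul_phi, h, sqExcess]
  ring

theorem isStationary_iff {ρ τ : ℝ} (hρ : ρ < 1) (hτ : 0 < τ) :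
    IsStationary ρ τ ↔ ρ * τ = (1 - ρ) * meanExcess τ := by
  have h : (Ioi τ).indicator (fun u : ℝ => u / τ - 1) = fun u => τ⁻¹ * max (u - τ) 0 := by
    ext u
    by_cases h : u ∈ Ioi τ
    · rw [indicator_of_mem h, max_eq_left (by simpa using (mem_Ioi.1 h).le)]
      field_simp
    · rw [indicator_of_notMem h, max_eq_right (by simpa using h)]
      simp
  have h1 : (0 : ℝ) < 1 - ρ := by linarith
  rw [IsStationary, setIntegral_mul_phi, h, integral_const_mul, ← meanExcess, div_eq_iff h1.ne']
  constructor
  · intro h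
    field_simp at h
    linarith
  · intro h
    field_simp
    linarith

theorem memLp_id_gaussian : MemLp (fun u : ℝ => u) 2 (gaussianReal 0 1) :=
  memLp_id_gaussianReal 2

theorem memLp_sub_gaussian (τ : ℝ) : MemLp (fun u : ℝ => u - τ) 2 (gaussianReal 0 1) :=
  memLp_id_gaussian.sub (memLp_const τ)

theorem memLp_excess (τ : ℝ) : MemLp (fun u : ℝ => max (u - τ) 0) 2 (gaussianReal 0 1) := by
  refine (memLp_sub_gaussian τ).of_le (by fun_prop) (Eventually.of_forall fun u => ?_)
  rw [Real.norm_eq_abs, Real.norm_eq_abs, abs_of_nonneg (le_max_right _ _)]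
  exact max_le (le_abs_self _) (abs_nonneg _)

theorem integrable_excess (τ : ℝ) : Integrable (fun u : ℝ => max (u - τ) 0) (gaussianReal 0 1) :=
  (memLp_excess τ).integrable one_le_two

theorem integral_sq_gaussian : ∫ u : ℝ, u ^ 2 ∂(gaussianReal 0 1) = 1 := by
  have h := variance_eq_sub memLp_id_gaussian
  rw [variance_fun_id_gaussianReal, integral_id_gaussianReal] at h
  simpa using h.symm

theorem meanExcess_nonneg (τ : ℝ) : 0 ≤ meanExcess τ := integral_nonneg fun _ => le_max_right _ _

theorem sqExcess_nonneg (τ : ℝ) : 0 ≤ sqExcess τ := integral_nonneg fun _ => sq_nonneg _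

theorem sqExcess_zero_le_one : sqExcess 0 ≤ 1 := by
  rw [← integral_sq_gaussian]
  refine integral_mono (memLp_excess 0).integrable_sq memLp_id_gaussian.integrable_sq fun u => ?_
  dsimp only
  rcases le_total u 0 with h | h
  · simp [h, sq_nonneg]
  · simp [h]

theorem meanExcess_antitone : Antitone meanExcess := fun a b hab =>
  integral_mono (integrable_excess b) (integrable_excess a)
    fun _ => max_le_max_right 0 (by linarith)

theorem meanExcess_lipschitz : LipschitzWith 1 meanExcess := by
  refine LipschitzWith.of_le_add_mul 1 fun a b => ?_
  have h : ∫ u, max (u - a) 0 ∂(gaussianReal 0 1) ≤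
      ∫ u, (max (u - b) 0 + |a - b|) ∂(gaussianReal 0 1) := by
    refine integral_mono (integrable_excess a) ((integrable_excess b).add (integrable_const _))
      fun u => max_le ?_ (by positivity)
    have h1 := le_max_left (u - b) 0
    have h2 := neg_abs_le (a - b)
    linarith
  rw [integral_add (integrable_excess b) (integrable_const _)] at h
  simpa [meanExcess, Real.dist_eq] using h

/-- As `|g| = 2g₊ - g` and `E g = 0`, a vanishing `E g₊` would force `g = 0` almost surely, against
`E g² = 1`. -/
theorem meanExcess_zero_pos : 0 < meanExcess 0 := by
  refine (meanExcess_nonneg 0).lt_of_ne fun h => ?_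
  have hid : Integrable (fun u : ℝ => u) (gaussianReal 0 1) :=
    memLp_id_gaussian.integrable one_le_two
  have h1 : ∫ u : ℝ, |u| ∂(gaussianReal 0 1) = 0 := by
    have h2 : (fun u : ℝ => |u|) = fun u => 2 * max (u - 0) 0 - u := by
      ext u
      rcases le_total u 0 with h | h
      · simp [h, abs_of_nonpos h]
      · simp [h, abs_of_nonneg h]
        ring
    rw [h2, integral_sub ((integrable_excess 0).const_mul 2) hid, integral_const_mul,
      ← meanExcess, ← h, integral_id_gaussianReal]
    simp
  rw [integral_eq_zero_iff_of_nonneg (fun _ => abs_nonneg _) hid.abs] at h1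
  have h3 : ∫ u : ℝ, u ^ 2 ∂(gaussianReal 0 1) = ∫ u : ℝ, 0 ∂(gaussianReal 0 1) :=
    integral_congr_ae (h1.mono fun u hu => by simpa using hu)
  simp [integral_sq_gaussian] at h3

/-! ### Convexity of the objective and its minimizer -/

/-- The convex function `a ↦ (u - a)₊²` lies above its tangent at `a`, of slope `-2(u - a)₊`. -/
theorem excess_sq_ge (u a b : ℝ) :
    max (u - a) 0 ^ 2 - 2 * max (u - a) 0 * (b - a) ≤ max (u - b) 0 ^ 2 := by
  rcases le_total (u - a) 0 with h | h
  · simp [max_eq_right h]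
  · rw [max_eq_left h]
    rcases le_total (u - b) 0 with h' | h'
    · rw [max_eq_right h']
      nlinarith
    · rw [max_eq_left h']
      nlinarith [sq_nonneg (b - a)]

theorem sqExcess_ge (a b : ℝ) : sqExcess a - 2 * meanExcess a * (b - a) ≤ sqExcess b := by
  have h := integral_mono (μ := gaussianReal 0 1)
    ((memLp_excess a).integrable_sq.sub (((integrable_excess a).const_mul 2).mul_const (b - a)))
    (memLp_excess b).integrable_sq fun u => excess_sq_ge u a b
  simp only [Pi.sub_apply] at h
  rw [integral_sub (memLp_excess a).integrable_sq
    (((integrable_excess a).const_mul 2).mul_const (b - a)), integral_mul_const,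
    integral_const_mul] at h
  exact h

/-- The term `ρ τ²` contributes the quadratic gap exactly, `sqExcess` lies above its tangent, and
stationarity cancels the linear terms. -/
theorem psi2Objective_ge {ρ a b : ℝ} (hρ : ρ ≤ 1) (h : ρ * a = (1 - ρ) * meanExcess a) :
    psi2Objective ρ a + ρ * (b - a) ^ 2 ≤ psi2Objective ρ b := by
  rw [psi2Objective_eq, psi2Objective_eq]
  have h1 := mul_le_mul_of_nonneg_left (sqExcess_ge a b) (sub_nonneg.2 hρ)
  linear_combination h1 - 2 * (b - a) * h

theorem exists_stationary {ρ : ℝ} (h0 : 0 < ρ) (h1 : ρ < 1) :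
    ∃ τ, 0 < τ ∧ ρ * τ = (1 - ρ) * meanExcess τ := by
  have hm := meanExcess_zero_pos
  have hρ : 0 < 1 - ρ := sub_pos.2 h1
  -- With this `b`, `ρ b = (1 - ρ) * meanExcess 0 ≥ (1 - ρ) * meanExcess b`, so the sign changes on
  -- `[0, b]`.
  set b := (1 - ρ) * meanExcess 0 / ρ with hb
  have hb0 : 0 ≤ b := by positivity
  have hcont : Continuous fun τ => ρ * τ - (1 - ρ) * meanExcess τ := by
    have := meanExcess_lipschitz.continuous
    fun_prop
  have hbρ : ρ * b = (1 - ρ) * meanExcess 0 := by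
    rw [hb]
    field_simp
  obtain ⟨τ, hτ, hτe⟩ := intermediate_value_Icc hb0 hcont.continuousOn
    (show (0 : ℝ) ∈ Icc _ _ from ⟨by nlinarith, by
      have := mul_le_mul_of_nonneg_left (meanExcess_antitone hb0) hρ.le
      linarith⟩)
  simp only at hτe
  refine ⟨τ, hτ.1.lt_of_ne ?_, by linarith⟩
  rintro rfl
  nlinarith

theorem stationary_unique {ρ a b : ℝ} (h0 : 0 < ρ) (h1 : ρ < 1)
    (ha : ρ * a = (1 - ρ) * meanExcess a) (hb : ρ * b = (1 - ρ) * meanExcess b) : a = b := by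
  have h2 := psi2Objective_ge (b := b) h1.le ha
  have h3 := psi2Objective_ge (b := a) h1.le hb
  have h4 : (b - a) ^ 2 ≤ 0 := by nlinarith [sq_nonneg (b - a)]
  have h5 := pow_eq_zero_iff two_ne_zero |>.1 (le_antisymm h4 (sq_nonneg _))
  linarith

theorem psi2Objective_nonneg {ρ : ℝ} (hρ : ρ ∈ Icc (0 : ℝ) 1) (τ : ℝ) :
    0 ≤ psi2Objective ρ τ := by
  rw [psi2Objective_eq]
  have := mul_nonneg (sub_nonneg.2 hρ.2) (sqExcess_nonneg τ)
  have := mul_nonneg hρ.1 (by positivity : 0 ≤ 1 + τ ^ 2)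
  linarith

theorem psi2_le {ρ τ : ℝ} (hρ : ρ ∈ Icc (0 : ℝ) 1) (hτ : 0 ≤ τ) :
    psi2 ρ ≤ psi2Objective ρ τ :=
  csInf_le ⟨0, by rintro _ ⟨t, -, rfl⟩; exact psi2Objective_nonneg hρ t⟩ ⟨τ, hτ, rfl⟩

theorem le_psi2 {ρ c : ℝ} (h : ∀ τ, 0 ≤ τ → c ≤ psi2Objective ρ τ) : c ≤ psi2 ρ :=
  le_csInf ⟨_, 0, self_mem_Ici, rfl⟩ (by rintro _ ⟨t, ht, rfl⟩; exact h t ht)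

theorem psi2_mem_Icc {ρ : ℝ} (hρ : ρ ∈ Icc (0 : ℝ) 1) : psi2 ρ ∈ Icc (0 : ℝ) 1 := by
  refine ⟨le_psi2 fun τ _ => psi2Objective_nonneg hρ τ, (psi2_le hρ le_rfl).trans ?_⟩
  rw [psi2Objective_eq]
  have := mul_le_mul_of_nonneg_left sqExcess_zero_le_one (sub_nonneg.2 hρ.2)
  linarith

theorem psi2_eq_of_stationary {ρ τ : ℝ} (hρ : ρ ∈ Icc (0 : ℝ) 1) (hτ : 0 ≤ τ)
    (h : ρ * τ = (1 - ρ) * meanExcess τ) : psi2 ρ = psi2Objective ρ τ := by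
  refine le_antisymm (psi2_le hρ hτ) (le_psi2 fun t _ => ?_)
  have := psi2Objective_ge (b := t) hρ.2 h
  have := mul_nonneg hρ.1 (sq_nonneg (t - τ))
  linarith

theorem psi2Objective_eq_psi2_iff {ρ τ : ℝ} (hρ : ρ ∈ Ioc (0 : ℝ) 1) (hτ : 0 ≤ τ)
    (h : ρ * τ = (1 - ρ) * meanExcess τ) (t : ℝ) : psi2Objective ρ t = psi2 ρ ↔ t = τ := by
  rw [psi2_eq_of_stationary ⟨hρ.1.le, hρ.2⟩ hτ h]
  refine ⟨fun ht => ?_, fun ht => by rw [ht]⟩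
  have h1 := psi2Objective_ge (b := t) hρ.2 h
  have h2 : (t - τ) ^ 2 ≤ 0 := by
    by_contra! h3
    have := mul_pos hρ.1 h3
    linarith
  have h5 := pow_eq_zero_iff two_ne_zero |>.1 (le_antisymm h2 (sq_nonneg _))
  linarith

/-! ### An inequality by Gaussian integration by parts -/

theorem integrable_pow_mul_exp (k : ℕ) :
    Integrable fun u : ℝ => u ^ k * Real.exp (-(1 / 2) * u ^ 2) := by
  have h := integrable_rpow_mul_exp_neg_mul_sq (b := 1 / 2) (by norm_num) (s := k)
    (by linarith [Nat.cast_nonneg (α := ℝ) k])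
  simpa using h

theorem integral_excess_eq (f : ℝ → ℝ) (τ : ℝ) :
    ∫ u, (Ioi τ).indicator f u ∂(gaussianReal 0 1) =
      (√(2 * Real.pi))⁻¹ * ∫ u in Ioi τ, f u * Real.exp (-(1 / 2) * u ^ 2) := by
  rw [integral_gaussianReal_eq_integral_smul one_ne_zero, ← integral_indicator measurableSet_Ioi,
    ← integral_const_mul]
  refine integral_congr_ae (Eventually.of_forall fun u => ?_)
  by_cases h : u ∈ Ioi τ
  · simp [indicator_of_mem h, gaussianPDFReal]
    ring_nf
  · simp [indicator_of_notMem h]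

/-- Integration by parts gives `E g (g - τ)₊² = 2 E (g - τ)₊`, and `g ≥ τ` wherever the left
integrand is non-zero. -/
theorem mul_sqExcess_le {τ : ℝ} (hτ : 0 ≤ τ) : τ * sqExcess τ ≤ 2 * meanExcess τ := by
  have h1 : (fun u : ℝ => max (u - τ) 0) = (Ioi τ).indicator fun u => u - τ := by
    ext u
    by_cases h : u ∈ Ioi τ
    · rw [indicator_of_mem h, max_eq_left (by simpa using (mem_Ioi.1 h).le)]
    · rw [indicator_of_notMem h, max_eq_right (by simpa using h)]
  have h2 : (fun u : ℝ => max (u - τ) 0 ^ 2) = (Ioi τ).indicator fun u => (u - τ) ^ 2 := by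
    ext u
    by_cases h : u ∈ Ioi τ
    · rw [indicator_of_mem h, max_eq_left (by simpa using (mem_Ioi.1 h).le)]
    · rw [indicator_of_notMem h, max_eq_right (by simpa using h)]
      simp
  rw [sqExcess, meanExcess, h1, h2, integral_excess_eq, integral_excess_eq]
  have e (u : ℝ) : HasDerivAt (fun u : ℝ => Real.exp (-(1 / 2) * u ^ 2))
      (-u * Real.exp (-(1 / 2) * u ^ 2)) u := by
    have := ((hasDerivAt_pow 2 u).const_mul (-(1 / 2) : ℝ)).exp
    convert this using 1
    simp
    ring
  have hi1 : Integrable fun u : ℝ => (u - τ) * Real.exp (-(1 / 2) * u ^ 2) := by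
    convert (integrable_pow_mul_exp 1).sub ((integrable_pow_mul_exp 0).const_mul τ) using 1
    ext u
    simp
    ring
  have hi2 : Integrable fun u : ℝ => (u - τ) ^ 2 * Real.exp (-(1 / 2) * u ^ 2) := by
    refine (((integrable_pow_mul_exp 2).sub ((integrable_pow_mul_exp 1).const_mul (2 * τ))).add
      ((integrable_pow_mul_exp 0).const_mul (τ ^ 2))).congr (ae_of_all _ fun u => ?_)
    simp
    ring
  have hi3 : Integrable fun u : ℝ => (u - τ) ^ 2 * u * Real.exp (-(1 / 2) * u ^ 2) := by
    refine (((integrable_pow_mul_exp 3).sub ((integrable_pow_mul_exp 2).const_mul (2 * τ))).add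
      ((integrable_pow_mul_exp 1).const_mul (τ ^ 2))).congr (ae_of_all _ fun u => ?_)
    simp
    ring
  have hlim : Tendsto (fun u : ℝ => -((u - τ) ^ 2 * Real.exp (-(1 / 2) * u ^ 2))) atTop (𝓝 0) := by
    have h3 := (tendsto_rpow_abs_mul_exp_neg_mul_sq_cocompact (a := 1 / 2) (by norm_num) 2).mono_left
      (atTop_le_cocompact (α := ℝ))
    rw [← neg_zero]
    refine (squeeze_zero' (Eventually.of_forall fun u => by positivity) ?_ h3).neg
    filter_upwards [eventually_ge_atTop τ] with u hu
    have : |u| ^ (2 : ℝ) = u ^ 2 := by simp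
    rw [this]
    gcongr
    nlinarith
  have hd (u : ℝ) : HasDerivAt (fun u : ℝ => -((u - τ) ^ 2 * Real.exp (-(1 / 2) * u ^ 2)))
      ((u - τ) ^ 2 * u * Real.exp (-(1 / 2) * u ^ 2)
        - 2 * ((u - τ) * Real.exp (-(1 / 2) * u ^ 2))) u := by
    refine (((((hasDerivAt_id' u).sub_const τ).fun_pow 2).fun_mul (e u)).fun_neg).congr_deriv ?_
    push_cast
    ring
  have hparts := integral_Ioi_of_hasDerivAt_of_tendsto' (a := τ) (fun u _ => hd u)
    (hi3.sub (hi1.const_mul 2)).integrableOn hlim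
  rw [integral_sub hi3.integrableOn (hi1.const_mul 2).integrableOn, integral_const_mul] at hparts
  have hle : ∫ u in Ioi τ, τ * ((u - τ) ^ 2 * Real.exp (-(1 / 2) * u ^ 2)) ≤
      ∫ u in Ioi τ, (u - τ) ^ 2 * u * Real.exp (-(1 / 2) * u ^ 2) := by
    refine setIntegral_mono_on (hi2.const_mul τ).integrableOn hi3.integrableOn measurableSet_Ioi
      fun u hu => ?_
    have := mul_le_mul_of_nonneg_left (mem_Ioi.1 hu).le
      (by positivity : 0 ≤ (u - τ) ^ 2 * Real.exp (-(1 / 2) * u ^ 2))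
    linarith
  rw [integral_const_mul] at hle
  simp only [sub_self, ne_eq, OfNat.ofNat_ne_zero, not_false_eq_true, zero_pow, zero_mul, neg_zero]
    at hparts
  rw [sub_eq_zero] at hparts
  rw [hparts] at hle
  have hc : 0 ≤ (√(2 * Real.pi))⁻¹ := by positivity
  have := mul_le_mul_of_nonneg_left hle hc
  linarith

/-! ### The cone and duality for its support function -/

theorem mem_priorRestrictedCone_iff {n : ℕ} {x : EuclideanSpace ℝ (Fin n)}
    (hx : x ∈ nonnegOrthant n) (u : EuclideanSpace ℝ (Fin n)) :
    u ∈ priorRestrictedCone (l1NonnegFunctions n) x ↔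
      (∀ i, x i = 0 → 0 ≤ u i) ∧ ∑ i, u i ≤ 0 := by
  have key (t : ℝ) : (∀ i, l1NonnegFunctions n i (x + t • u) ≤ l1NonnegFunctions n i x) ↔
      (∀ i, 0 ≤ x i + t * u i) ∧ t * ∑ i, u i ≤ 0 := by
    have hmem : x + t • u ∈ nonnegOrthant n ↔ ∀ i, 0 ≤ x i + t * u i := by
      simp [nonnegOrthant]
    have hind : convexIndicator (nonnegOrthant n) (x + t • u) ≤
        convexIndicator (nonnegOrthant n) x ↔ x + t • u ∈ nonnegOrthant n := by
      rw [convexIndicator, convexIndicator, if_pos hx]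
      split_ifs with h <;> simp [h]
    rw [Fin.forall_fin_two]
    simp only [l1NonnegFunctions, Matrix.cons_val_zero, Matrix.cons_val_one, hind, hmem,
      EReal.coe_le_coe_iff]
    rw [and_comm]
    refine and_congr_right fun h => ?_
    have h1 : ∑ i, |(x + t • u) i| = ∑ i, x i + t * ∑ i, u i := by
      rw [Finset.mul_sum, ← Finset.sum_add_distrib]
      exact Finset.sum_congr rfl fun i _ => abs_of_nonneg (h i)
    have h2 : ∑ i, |x i| = ∑ i, x i := Finset.sum_congr rfl fun i _ => abs_of_nonneg (hx i)
    rw [h1, h2]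
    simp
  constructor
  · rintro ⟨t, ht, h⟩
    obtain ⟨h1, h2⟩ := (key t).1 h
    exact ⟨fun i hi => (mul_nonneg_iff_of_pos_left ht).1 (by simpa [hi] using h1 i),
      nonpos_of_mul_nonpos_right h2 ht⟩
  · rintro ⟨h1, h2⟩
    -- Only the finitely many positive entries of `x` limit the step, so every small `t > 0` works.
    have hev : ∀ᶠ t : ℝ in 𝓝[>] 0, ∀ i, 0 ≤ x i + t * u i := by
      refine eventually_all.2 fun i => ?_
      rcases (hx i).eq_or_lt with h | h
      · filter_upwards [self_mem_nhdsWithin] with t ht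
        rw [← h, zero_add]
        exact mul_nonneg (mem_Ioi.1 ht).le (h1 i h.symm)
      · have hc : ContinuousAt (fun t : ℝ => x i + t * u i) 0 := by fun_prop
        have := hc.eventually (lt_mem_nhds (a := 0) (by simpa using h))
        exact (this.filter_mono nhdsWithin_le_nhds).mono fun t ht => ht.le
    obtain ⟨t, ht, ht0⟩ := (hev.and self_mem_nhdsWithin).exists
    exact ⟨t, ht0, (key t).2 ⟨ht, mul_nonpos_of_nonneg_of_nonpos (mem_Ioi.1 ht0).le h2⟩⟩

/-- The coordinate of `g - Π g` at which `x` is `a` and `g` is `u`, where `Π` is the projection to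
`τ` times the subdifferential at `x` of the `ℓ¹` norm on the orthant. -/
noncomputable def residual (a τ u : ℝ) : ℝ := if a = 0 then max (u - τ) 0 else u - τ

theorem residual_mul_self (a τ u : ℝ) :
    residual a τ u * residual a τ u = (u - τ) * residual a τ u := by
  unfold residual
  split_ifs
  · rcases le_total (u - τ) 0 with h | h <;> simp [h]
  · rfl

theorem continuous_residual (a u : ℝ) : Continuous fun τ => residual a τ u := by
  unfold residual
  split_ifs <;> fun_prop

/-- Tangent-line bound; where `c ≠ 0` the square is exactly quadratic in `τ`, which keeps the
curvature term. -/
theorem residual_sq_ge (c a b u : ℝ) :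
    residual c a u ^ 2 - 2 * residual c a u * (b - a) + (if c = 0 then 0 else (b - a) ^ 2) ≤
      residual c b u ^ 2 := by
  unfold residual
  split_ifs
  · have := excess_sq_ge u a b
    linarith
  · exact le_of_eq (by ring)

theorem coneSupport_nonneg {n : ℕ} {K : Set (EuclideanSpace ℝ (Fin n))} (h0 : 0 ∈ K)
    (g : EuclideanSpace ℝ (Fin n)) : 0 ≤ coneSupport K g :=
  le_csSup (coneSupport_bddAbove K g) ⟨0, ⟨h0, by simp⟩, by simp⟩

/-- Weak duality: `g i ≤ r i + τ`, with equality on the support, so `⟨g, t⟩ ≤ ⟨r, t⟩ + τ ∑ t i ≤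
‖r‖`. -/
theorem coneSupport_sq_le {n : ℕ} {x : EuclideanSpace ℝ (Fin n)} (hx : x ∈ nonnegOrthant n)
    {τ : ℝ} (hτ : 0 ≤ τ) (g : EuclideanSpace ℝ (Fin n)) :
    coneSupport (priorRestrictedCone (l1NonnegFunctions n) x) g ^ 2 ≤
      ∑ i, residual (x i) τ (g i) ^ 2 := by
  have h0 := zero_mem_priorRestrictedCone (l1NonnegFunctions n) x
  set r : EuclideanSpace ℝ (Fin n) := WithLp.toLp 2 fun i => residual (x i) τ (g i) with hr
  have hnorm : ‖r‖ ^ 2 = ∑ i, residual (x i) τ (g i) ^ 2 := by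
    rw [EuclideanSpace.real_norm_sq_eq]
  rw [← hnorm]
  refine pow_le_pow_left₀ (coneSupport_nonneg h0 g) (csSup_le ⟨_, 0, ⟨h0, by simp⟩, rfl⟩ ?_) 2
  rintro _ ⟨t, ⟨htK, htB⟩, rfl⟩
  obtain ⟨h1, h2⟩ := (mem_priorRestrictedCone_iff hx t).1 htK
  have h3 : inner ℝ g t ≤ inner ℝ r t + τ * ∑ i, t i := by
    rw [PiLp.inner_apply, PiLp.inner_apply, Finset.mul_sum, ← Finset.sum_add_distrib]
    refine Finset.sum_le_sum fun i _ => ?_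
    simp only [hr, RCLike.inner_apply, conj_trivial]
    by_cases hi : x i = 0
    · have h4 := mul_le_mul_of_nonneg_left (le_max_left (g i - τ) 0) (h1 i hi)
      simp only [residual, if_pos hi]
      linarith
    · simp only [residual, if_neg hi]
      exact le_of_eq (by ring)
  have h4 : inner ℝ r t ≤ ‖r‖ :=
    (real_inner_le_norm r t).trans
      (mul_le_of_le_one_right (norm_nonneg r) (mem_closedBall_zero_iff.1 htB))
  have := mul_nonpos_of_nonneg_of_nonpos hτ h2
  simp only
  linarith

/-- Supplies the optimal multiplier: primal feasibility of the residual together with complementary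
slackness. -/
theorem exists_sum_residual_nonpos {n : ℕ} (x g : EuclideanSpace ℝ (Fin n)) :
    ∃ τ, 0 ≤ τ ∧ ∑ i, residual (x i) τ (g i) ≤ 0 ∧ τ * ∑ i, residual (x i) τ (g i) = 0 := by
  by_cases h : ∑ i, residual (x i) 0 (g i) ≤ 0
  · exact ⟨0, le_rfl, h, zero_mul _⟩
  push Not at h
  have hT : 0 ≤ ∑ i, |g i| := Finset.sum_nonneg fun i _ => abs_nonneg _
  -- Every `g i` is at most `∑ |g i|`, so at this `τ` no residual is positive.
  have hneg : ∑ i, residual (x i) (∑ i, |g i|) (g i) ≤ 0 := by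
    refine Finset.sum_nonpos fun i _ => ?_
    have h1 : g i ≤ ∑ i, |g i| := (le_abs_self _).trans
      (Finset.single_le_sum (f := fun i => |g i|) (fun i _ => abs_nonneg _) (Finset.mem_univ i))
    unfold residual
    split_ifs
    · exact max_le (by linarith) le_rfl
    · linarith
  have hc : Continuous fun τ => ∑ i, residual (x i) τ (g i) :=
    continuous_finsetSum _ fun i _ => continuous_residual _ _
  obtain ⟨τ, hτ, he⟩ := intermediate_value_Icc' hT hc.continuousOn
    (show (0 : ℝ) ∈ Icc _ _ from ⟨hneg, h.le⟩)
  simp only at he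
  exact ⟨τ, hτ.1, he.le, by rw [he, mul_zero]⟩

/-- Strong duality: the normalized residual is feasible, and slackness gives `⟨g, r⟩ = ‖r‖²`. If `r
= 0`, the convention `0⁻¹ = 0` makes the witness `0`. -/
theorem exists_sum_residual_sq_le {n : ℕ} {x : EuclideanSpace ℝ (Fin n)}
    (hx : x ∈ nonnegOrthant n) (g : EuclideanSpace ℝ (Fin n)) :
    ∃ τ, 0 ≤ τ ∧ ∑ i, residual (x i) τ (g i) ^ 2 ≤
      coneSupport (priorRestrictedCone (l1NonnegFunctions n) x) g ^ 2 := by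
  obtain ⟨τ, hτ, h1, h2⟩ := exists_sum_residual_nonpos x g
  refine ⟨τ, hτ, ?_⟩
  set r : EuclideanSpace ℝ (Fin n) := WithLp.toLp 2 fun i => residual (x i) τ (g i) with hr
  have hnorm : ‖r‖ ^ 2 = ∑ i, residual (x i) τ (g i) ^ 2 := by
    rw [EuclideanSpace.real_norm_sq_eq]
  rw [← hnorm]
  refine pow_le_pow_left₀ (norm_nonneg r) ?_ 2
  have hK : ‖r‖⁻¹ • r ∈ priorRestrictedCone (l1NonnegFunctions n) x := by
    rw [mem_priorRestrictedCone_iff hx]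
    have h3 : 0 ≤ ‖r‖⁻¹ := by positivity
    refine ⟨fun i hi => ?_, ?_⟩
    · simp only [PiLp.smul_apply, smul_eq_mul, hr, residual, if_pos hi]
      positivity
    · simp only [PiLp.smul_apply, smul_eq_mul, ← Finset.mul_sum]
      exact mul_nonpos_of_nonneg_of_nonpos h3 h1
  have hB : ‖r‖⁻¹ • r ∈ Metric.closedBall (0 : EuclideanSpace ℝ (Fin n)) 1 := by
    rw [mem_closedBall_zero_iff, norm_smul, norm_inv, norm_norm]
    exact inv_mul_le_one
  have hin : inner ℝ g r = ‖r‖ ^ 2 := by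
    rw [hnorm, PiLp.inner_apply]
    have h4 (i : Fin n) : inner ℝ (g i) (r i) =
        residual (x i) τ (g i) ^ 2 + τ * residual (x i) τ (g i) := by
      simp only [hr, RCLike.inner_apply, conj_trivial]
      linarith [residual_mul_self (x i) τ (g i)]
    simp only [h4]
    rw [Finset.sum_add_distrib, ← Finset.mul_sum, h2, add_zero]
  refine le_trans (le_of_eq ?_) (le_csSup (coneSupport_bddAbove _ g) ⟨_, ⟨hK, hB⟩, rfl⟩)
  simp only [inner_smul_right, hin]
  rcases eq_or_ne ‖r‖ 0 with h | h
  · simp [h]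
  · field_simp

theorem sum_ite_eq_zero {n s : ℕ} {x : EuclideanSpace ℝ (Fin n)}
    (hs : ncard {i | x i ≠ 0} = s) (A B : ℝ) :
    ∑ i, (if x i = 0 then A else B) = (n - s) * A + s * B := by
  have h1 : ((Finset.univ.filter fun i => x i ≠ 0).card : ℝ) = s := by
    rw [← hs, ncard_eq_toFinset_card']
    simp
  have h2 := Finset.card_filter_add_card_filter_not (s := (Finset.univ : Finset (Fin n)))
    (fun i => x i = 0)
  have h3 : ((Finset.univ.filter fun i => x i = 0).card : ℝ) = n - s := by
    rw [← h1, eq_sub_iff_add_eq]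
    exact_mod_cast (by simpa using h2)
  rw [Finset.sum_ite, Finset.sum_const, Finset.sum_const, nsmul_eq_mul, nsmul_eq_mul, h3]
  simp only [ne_eq] at h1
  rw [h1]

/-- Replaces the optimal multiplier `b`, which depends on `g`, by a fixed `τ`: the loss `2Yd - s
d²`, `d = b - τ`, is at most `Y²/s` for every `d`. -/
theorem coneSupport_sq_ge {n s : ℕ} {x : EuclideanSpace ℝ (Fin n)} (hx : x ∈ nonnegOrthant n)
    (hs : ncard {i | x i ≠ 0} = s) (hs0 : 0 < s) (τ : ℝ) (g : EuclideanSpace ℝ (Fin n)) :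
    ∑ i, residual (x i) τ (g i) ^ 2 - (∑ i, residual (x i) τ (g i)) ^ 2 / s ≤
      coneSupport (priorRestrictedCone (l1NonnegFunctions n) x) g ^ 2 := by
  obtain ⟨b, -, hb⟩ := exists_sum_residual_sq_le hx g
  refine le_trans ?_ hb
  have h := Finset.sum_le_sum fun i (_ : i ∈ Finset.univ) => residual_sq_ge (x i) τ b (g i)
  rw [Finset.sum_add_distrib, Finset.sum_sub_distrib, ← Finset.sum_mul, ← Finset.mul_sum,
    sum_ite_eq_zero hs] at h
  have hs' : (0 : ℝ) < s := by exact_mod_cast hs0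
  set Y := ∑ i, residual (x i) τ (g i)
  have h2 : 2 * Y * (b - τ) - s * (b - τ) ^ 2 ≤ Y ^ 2 / s := by
    rw [le_div_iff₀ hs']
    nlinarith [sq_nonneg (Y - s * (b - τ))]
  linarith

/-! ### Moments of the residuals -/

theorem memLp_residual (a τ : ℝ) : MemLp (residual a τ) 2 (gaussianReal 0 1) := by
  by_cases h : a = 0
  · have : residual a τ = fun u => max (u - τ) 0 := by ext u; simp [residual, h]
    rw [this]
    exact memLp_excess τ
  · have : residual a τ = fun u => u - τ := by ext u; simp [residual, h]
    rw [this]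
    exact memLp_sub_gaussian τ

theorem integral_residual (a τ : ℝ) :
    ∫ u, residual a τ u ∂(gaussianReal 0 1) = if a = 0 then meanExcess τ else -τ := by
  unfold residual
  split_ifs
  · rfl
  · rw [integral_sub (memLp_id_gaussian.integrable one_le_two) (integrable_const _),
      integral_id_gaussianReal]
    simp

theorem integral_residual_sq (a τ : ℝ) :
    ∫ u, residual a τ u ^ 2 ∂(gaussianReal 0 1) = if a = 0 then sqExcess τ else 1 + τ ^ 2 := by
  unfold residual
  split_ifs
  · rfl
  · have hid : Integrable (fun u : ℝ => u) (gaussianReal 0 1) :=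
      memLp_id_gaussian.integrable one_le_two
    have h (u : ℝ) : (u - τ) ^ 2 = u ^ 2 - 2 * τ * u + τ ^ 2 := by ring
    simp only [h]
    have hsub : Integrable (fun u : ℝ => u ^ 2 - 2 * τ * u) (gaussianReal 0 1) :=
      memLp_id_gaussian.integrable_sq.sub (hid.const_mul _)
    rw [integral_add hsub (integrable_const _),
      integral_sub memLp_id_gaussian.integrable_sq (hid.const_mul _), integral_const_mul,
      integral_id_gaussianReal, integral_sq_gaussian]
    simp

theorem variance_residual_le (a τ : ℝ) :
    Var[residual a τ; gaussianReal 0 1] ≤ if a = 0 then sqExcess τ else 1 := by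
  rw [variance_eq_sub (memLp_residual a τ)]
  simp only [Pi.pow_apply]
  rw [integral_residual_sq, integral_residual]
  split_ifs
  · linarith [sq_nonneg (meanExcess τ)]
  · exact le_of_eq (by ring)

theorem sqExcess_antitone : Antitone sqExcess := fun a b hab =>
  integral_mono (memLp_excess b).integrable_sq (memLp_excess a).integrable_sq fun _ =>
    pow_le_pow_left₀ (le_max_right _ _) (max_le_max_right 0 (by linarith)) 2

/-! ### Independent coordinates of the Gaussian vector -/

section Coordinates

variable {n : ℕ}

theorem measurePreserving_eval_stdGaussian (i : Fin n) :
    MeasurePreserving (fun g : EuclideanSpace ℝ (Fin n) => g i)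
      (stdGaussian (EuclideanSpace ℝ (Fin n))) (gaussianReal 0 1) := by
  refine ⟨by fun_prop, ?_⟩
  rw [← map_pi_eq_stdGaussian, Measure.map_map (by fun_prop) (by fun_prop)]
  exact (measurePreserving_eval (fun _ : Fin n => gaussianReal 0 1) i).map_eq

theorem integral_eval_stdGaussian {f : ℝ → ℝ} (hf : Integrable f (gaussianReal 0 1)) (i : Fin n) :
    ∫ g : EuclideanSpace ℝ (Fin n), f (g i) ∂(stdGaussian _) = ∫ u, f u ∂(gaussianReal 0 1) := by
  have h := measurePreserving_eval_stdGaussian i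
  rw [← h.map_eq] at hf ⊢
  rw [integral_map h.aemeasurable hf.aestronglyMeasurable]

theorem variance_sum_eval_stdGaussian {f : Fin n → ℝ → ℝ}
    (hf : ∀ i, MemLp (f i) 2 (gaussianReal 0 1)) :
    Var[fun g : EuclideanSpace ℝ (Fin n) => ∑ i, f i (g i); stdGaussian _] =
      ∑ i, Var[f i; gaussianReal 0 1] := by
  rw [← variance_sum_pi hf, ← map_pi_eq_stdGaussian, variance_map]
  · congr 1
    ext u
    simp
  · rw [map_pi_eq_stdGaussian]
    exact (memLp_finsetSum Finset.univ fun i _ =>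
      (hf i).comp_measurePreserving (measurePreserving_eval_stdGaussian i)).aemeasurable
  · fun_prop

end Coordinates

/-! ### Taking expectations -/

section Bounds

variable {n s : ℕ} {x : EuclideanSpace ℝ (Fin n)}

theorem memLp_sum_residual (τ : ℝ) :
    MemLp (fun g : EuclideanSpace ℝ (Fin n) => ∑ i, residual (x i) τ (g i)) 2 (stdGaussian _) :=
  memLp_finsetSum Finset.univ fun i _ =>
    (memLp_residual (x i) τ).comp_measurePreserving (measurePreserving_eval_stdGaussian i)

theorem integrable_residual_sq_eval (τ : ℝ) (i : Fin n) :
    Integrable (fun g : EuclideanSpace ℝ (Fin n) => residual (x i) τ (g i) ^ 2) (stdGaussian _) :=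
  ((memLp_residual (x i) τ).comp_measurePreserving
    (measurePreserving_eval_stdGaussian i)).integrable_sq

theorem integral_sum_residual_sq (hn : 0 < n) (hs : ncard {i | x i ≠ 0} = s) (τ : ℝ) :
    ∫ g : EuclideanSpace ℝ (Fin n), ∑ i, residual (x i) τ (g i) ^ 2 ∂(stdGaussian _) =
      n * psi2Objective (s / n) τ := by
  rw [integral_finsetSum _ fun i _ => integrable_residual_sq_eval τ i]
  have h (i : Fin n) : ∫ g : EuclideanSpace ℝ (Fin n), residual (x i) τ (g i) ^ 2 ∂(stdGaussian _) =
      if x i = 0 then sqExcess τ else 1 + τ ^ 2 := by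
    rw [← integral_residual_sq,
      integral_eval_stdGaussian (f := fun u => residual (x i) τ u ^ 2)
        (memLp_residual (x i) τ).integrable_sq]
  simp only [h]
  rw [sum_ite_eq_zero hs, psi2Objective_eq]
  have : (n : ℝ) ≠ 0 := by exact_mod_cast hn.ne'
  field_simp
  ring

theorem integral_sum_residual (hs : ncard {i | x i ≠ 0} = s) (τ : ℝ) :
    ∫ g : EuclideanSpace ℝ (Fin n), ∑ i, residual (x i) τ (g i) ∂(stdGaussian _) =
      (n - s) * meanExcess τ - s * τ := by
  have hi (i : Fin n) : Integrable (fun g : EuclideanSpace ℝ (Fin n) => residual (x i) τ (g i))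
      (stdGaussian _) := ((memLp_residual (x i) τ).comp_measurePreserving
    (measurePreserving_eval_stdGaussian i)).integrable one_le_two
  rw [integral_finsetSum _ fun i _ => hi i]
  have h (i : Fin n) : ∫ g : EuclideanSpace ℝ (Fin n), residual (x i) τ (g i) ∂(stdGaussian _) =
      if x i = 0 then meanExcess τ else -τ := by
    rw [← integral_residual,
      integral_eval_stdGaussian ((memLp_residual (x i) τ).integrable one_le_two)]
  simp only [h]
  rw [sum_ite_eq_zero hs]
  ring

/-- Stationarity makes the sum centred, so its second moment is its variance, which adds over
independent coordinates. -/
theorem integral_sq_sum_residual_le (hs : ncard {i | x i ≠ 0} = s) {τ : ℝ}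
    (hτ : s * τ = (n - s) * meanExcess τ) :
    ∫ g : EuclideanSpace ℝ (Fin n), (∑ i, residual (x i) τ (g i)) ^ 2 ∂(stdGaussian _) ≤
      (n - s) * sqExcess τ + s := by
  have h1 := variance_eq_sub (memLp_sum_residual (x := x) τ)
  have h2 := variance_sum_eval_stdGaussian fun i => memLp_residual (x i) τ
  have h3 := Finset.sum_le_sum fun i (_ : i ∈ Finset.univ) => variance_residual_le (x i) τ
  rw [← h2, h1, integral_sum_residual hs, hτ, sub_self, sum_ite_eq_zero hs] at h3
  simpa using h3

theorem statDim_le (hn : 0 < n) (hx : x ∈ nonnegOrthant n) (hs : ncard {i | x i ≠ 0} = s) {τ : ℝ}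
    (hτ : 0 ≤ τ) :
    statDim (priorRestrictedCone (l1NonnegFunctions n) x) ≤ n * psi2Objective (s / n) τ := by
  rw [← integral_sum_residual_sq hn hs τ]
  exact integral_mono (integrable_coneSupport_sq (zero_mem_priorRestrictedCone _ x))
    (integrable_finsetSum _ fun i _ => integrable_residual_sq_eval τ i)
    fun g => coneSupport_sq_le hx hτ g

theorem le_statDim (hn : 0 < n) (hx : x ∈ nonnegOrthant n) (hs : ncard {i | x i ≠ 0} = s)
    (hs0 : 0 < s) {τ : ℝ} (hτ : s * τ = (n - s) * meanExcess τ) :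
    n * psi2Objective (s / n) τ - ((n - s) * sqExcess τ + s) / s ≤
      statDim (priorRestrictedCone (l1NonnegFunctions n) x) := by
  have hs' : (0 : ℝ) < s := by exact_mod_cast hs0
  have hi1 : Integrable (fun g : EuclideanSpace ℝ (Fin n) => ∑ i, residual (x i) τ (g i) ^ 2)
      (stdGaussian _) := integrable_finsetSum _ fun i _ => integrable_residual_sq_eval τ i
  have hi2 := (memLp_sum_residual (x := x) τ).integrable_sq.div_const (s : ℝ)
  have h := integral_mono (hi1.sub hi2)
    (integrable_coneSupport_sq (zero_mem_priorRestrictedCone _ x))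
    fun g => coneSupport_sq_ge hx hs hs0 τ g
  simp only [Pi.sub_apply] at h
  rw [integral_sub hi1 hi2, integral_div, integral_sum_residual_sq hn hs τ] at h
  refine le_trans ?_ h
  gcongr
  exact integral_sq_sum_residual_le hs hτ

end Bounds

/-! ### The error term of the lower bound -/

theorem psi2_sub_le_statDim_div {n s : ℕ} {x : EuclideanSpace ℝ (Fin n)} (hn : 0 < n)
    (hx : x ∈ nonnegOrthant n) (hs : ncard {i | x i ≠ 0} = s) (hsn : s ≤ n) (hs0 : 0 < s) :
    psi2 ((s : ℝ) / n) - 2 / √((s : ℝ) * n) ≤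
      statDim (priorRestrictedCone (l1NonnegFunctions n) x) / n := by
  have hn' : (0 : ℝ) < n := by exact_mod_cast hn
  have hs' : (0 : ℝ) < s := by exact_mod_cast hs0
  have hsn' : (s : ℝ) ≤ n := by exact_mod_cast hsn
  obtain ⟨τ, hτ, he, hq⟩ : ∃ τ : ℝ, 0 ≤ τ ∧ s * τ = (n - s) * meanExcess τ ∧
      (n - s) * sqExcess τ ≤ 2 * s := by
    rcases hsn.eq_or_lt with h | h
    -- For `s = n` the stationary point is `0`, where the factor `τ` could not be cancelled as
    -- below.
    · exact ⟨0, le_rfl, by simp [h], by simp [h]⟩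
    · have h1 : (s : ℝ) / n < 1 := (div_lt_one hn').2 (by exact_mod_cast h)
      obtain ⟨τ, hτ, he⟩ := exists_stationary (div_pos hs' hn') h1
      have he' : s * τ = (n - s) * meanExcess τ := by
        field_simp at he
        linarith
      refine ⟨τ, hτ.le, he', ?_⟩
      have h2 := mul_le_mul_of_nonneg_left (mul_sqExcess_le hτ.le) (sub_nonneg.2 hsn')
      -- `τ (n - s) * sqExcess τ ≤ 2 (n - s) * meanExcess τ = 2 s τ`; cancel `τ > 0`.
      refine le_of_mul_le_mul_left ?_ hτ
      linarith
  have hρ : (s : ℝ) / n ∈ Icc (0 : ℝ) 1 := ⟨by positivity, (div_le_one hn').2 hsn'⟩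
  have h1 := psi2_le hρ hτ
  have h2 := le_statDim hn hx hs hs0 he
  set V := (n - s) * sqExcess τ + s with hV
  have hV1 : V ≤ n := by
    have := mul_le_mul_of_nonneg_left
      ((sqExcess_antitone hτ).trans sqExcess_zero_le_one) (sub_nonneg.2 hsn')
    linarith
  have hV0 : 0 ≤ V := add_nonneg (mul_nonneg (sub_nonneg.2 hsn') (sqExcess_nonneg τ)) hs'.le
  have hsq : 0 < √((s : ℝ) * n) := by positivity
  have hsq2 : √((s : ℝ) * n) ^ 2 = s * n := Real.sq_sqrt (by positivity)
  -- `V ≤ 3s` and `V ≤ n` give `V² ≤ 3sn ≤ (2√(sn))²`.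
  have hV2 : V ≤ 2 * √((s : ℝ) * n) := by
    refine abs_le_of_sq_le_sq' ?_ (by positivity) |>.2
    rw [mul_pow, hsq2]
    have : V * V ≤ 3 * s * n := mul_le_mul (by linarith) hV1 hV0 (by positivity)
    nlinarith
  have h3 : V / s ≤ n * (2 / √((s : ℝ) * n)) := by
    rw [div_le_iff₀ hs']
    refine hV2.trans (le_of_eq ?_)
    field_simp
    linarith
  rw [le_div_iff₀ hn']
  have h4 := mul_le_mul_of_nonneg_left h1 hn'.le
  linarith

end PriorCone

theorem mainTheorem8 :
    -- the bounds on the statistical dimension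
    (∀ (n s : ℕ) (_hn : 0 < n) (x : EuclideanSpace ℝ (Fin n))
        (_hx : x ∈ PriorCone.nonnegOrthant n) (_hs : Set.ncard {i | x i ≠ 0} = s),
      (0 < s →
        PriorCone.psi2 ((s : ℝ) / n) - 2 / √((s : ℝ) * n) ≤
          PriorCone.statDim
            (PriorCone.priorRestrictedCone (PriorCone.l1NonnegFunctions n) x) / n) ∧
      PriorCone.statDim
          (PriorCone.priorRestrictedCone (PriorCone.l1NonnegFunctions n) x) / n ≤
        PriorCone.psi2 ((s : ℝ) / n)) ∧
    -- `ψ₂` maps `[0, 1]` to `[0, 1]`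
    (∀ ρ ∈ Set.Icc (0 : ℝ) 1, PriorCone.psi2 ρ ∈ Set.Icc (0 : ℝ) 1) ∧
    -- the infimum is attained exactly at the unique positive solution of the stationary equation
    (∀ ρ ∈ Set.Ioo (0 : ℝ) 1, ∃ τ : ℝ, 0 < τ ∧
      (∀ t : ℝ, 0 < t → (PriorCone.IsStationary ρ t ↔ t = τ)) ∧
      (∀ t : ℝ, 0 ≤ t → (PriorCone.psi2Objective ρ t = PriorCone.psi2 ρ ↔ t = τ))) ∧
    -- at `ρ = 1`, where the left side of the stationary equation is `+∞`, the minimizer is `0`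
    (∀ t : ℝ, 0 ≤ t → (PriorCone.psi2Objective 1 t = PriorCone.psi2 1 ↔ t = 0)) := by
  refine ⟨fun n s hn x hx hs => ?_, fun ρ hρ => PriorCone.psi2_mem_Icc hρ, fun ρ hρ => ?_,
    fun t _ => PriorCone.psi2Objective_eq_psi2_iff ⟨one_pos, le_rfl⟩ le_rfl (by simp) t⟩
  · have hsn : s ≤ n := by
      rw [← hs]
      exact (Set.ncard_le_card _).trans (by simp)
    refine ⟨PriorCone.psi2_sub_le_statDim_div hn hx hs hsn, PriorCone.le_psi2 fun τ hτ => ?_⟩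
    rw [div_le_iff₀' (by exact_mod_cast hn)]
    exact PriorCone.statDim_le hn hx hs hτ
  · obtain ⟨τ, hτ, he⟩ := PriorCone.exists_stationary hρ.1 hρ.2
    refine ⟨τ, hτ, fun t ht => ?_, fun t _ =>
      PriorCone.psi2Objective_eq_psi2_iff ⟨hρ.1, hρ.2.le⟩ hτ.le he t⟩
    rw [PriorCone.isStationary_iff hρ.2 ht]
    exact ⟨fun h => PriorCone.stationary_unique hρ.1 hρ.2 h he, fun h => h ▸ he⟩
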